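/- Let $R$ be a commutative ring with identity. An ideal $I$ of $R$ is called semi-regular if it contains a finitely generated ideal $J$ of $R$ with $(0:_R J)=\{r\in R \mid rJ=0\}=0$. The ring $R$ is called semi-regular coherent if every finitely generated semi-regular ideal of $R$ is finitely presented as an $R$-module. An $R$-module $M$ is called semi-regular flat if $\operatorname{Tor}_1^R(R/I,M)=0$ for every finitely generated semi-regular ideal $I$ of $R$; let $\mathcal F_{sr}$ denote the class of all semi-regular flat $R$-modules. Suppose that $R$ is semi-regular coherent and that $\mathcal F_{sr}$ is closed under inverse limits, that is, the limit of every inverse system of semi-regular flat modules indexed by a nonempty directed partially ordered set is semi-regular flat. Then $\mathcal F_{sr}$ is enveloping, that is, every $R$-module $M$ has an $\mathcal F_{sr}$-envelope: a homomorphism $\varphi\colon M\to F$ with $F\in\mathcal F_{sr}$ such that 1. for every $F'\in\mathcal F_{sr}$ and every homomorphism $f\colon M\to F'$ there is a homomorphism $g\colon F\to F'$ with $g\varphi=f$; and 2. every endomorphism $g$ of $F$ with $g\varphi=\varphi$ is an automorphism of $F$. -/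

import Mathlib

open CategoryTheory

universe u

/-- An ideal `I` is dense if `(0 :_R I) = {r | r I = 0}` is zero. -/
def IsDenseIdeal {R : Type u} [CommRing R] (I : Ideal R) : Prop :=
  Submodule.annihilator I = ⊥

/-- An ideal is semi-regular if it contains a finitely generated dense sub-ideal. -/
def IsSemiregularIdeal {R : Type u} [CommRing R] (I : Ideal R) : Prop :=
  ∃ J : Ideal R, J ≤ I ∧ J.FG ∧ IsDenseIdeal J

/-- A ring is semi-regular coherent if every finitely generated semi-regular ideal is finitely
presented as a module. -/
def IsSemiregularCoherent (R : Type u) [CommRing R] : Prop :=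
  ∀ I : Ideal R, I.FG → IsSemiregularIdeal I → Module.FinitePresentation R I

/-- The class of semi-regular flat modules: those `M` with `Tor₁(R ⧸ I, M) = 0` for every
finitely generated semi-regular ideal `I`. -/
def semiregularFlat (R : Type u) [CommRing R] : ObjectProperty (ModuleCat.{u} R) :=
  fun M => ∀ I : Ideal R, I.FG → IsSemiregularIdeal I →
    Limits.IsZero (((Tor (ModuleCat.{u} R) 1).obj (ModuleCat.of R (R ⧸ I))).obj M)

/-- `P` is closed under inverse limits: the limit of any inverse system, indexed by a nonempty
directed partially ordered set, of objects satisfying `P` again satisfies `P`. An inverse system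
indexed by `J` is a contravariant functor on `J`. -/
def IsClosedUnderInverseLimits {R : Type u} [CommRing R]
    (P : ObjectProperty (ModuleCat.{u} R)) : Prop :=
  ∀ (J : Type u) [PartialOrder J] [Nonempty J] [IsDirectedOrder J],
    P.IsClosedUnderLimitsOfShape Jᵒᵖ

/-- `φ : M ⟶ F` is a `P`-preenvelope of `M` if `F` is in `P` and every morphism from `M` to an
object of `P` factors through `φ`. -/
structure IsPreenvelope {R : Type u} [CommRing R] (P : ObjectProperty (ModuleCat.{u} R))
    {M F : ModuleCat.{u} R} (φ : M ⟶ F) : Prop where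
  mem : P F
  exists_fac : ∀ (F' : ModuleCat.{u} R), P F' → ∀ f : M ⟶ F', ∃ g : F ⟶ F', φ ≫ g = f

/-- A `P`-envelope of `M` is a `P`-preenvelope `φ : M ⟶ F` such that every endomorphism `g` of `F`
with `g ∘ φ = φ` is an automorphism. -/
structure IsEnvelope {R : Type u} [CommRing R] (P : ObjectProperty (ModuleCat.{u} R))
    {M F : ModuleCat.{u} R} (φ : M ⟶ F) : Prop extends IsPreenvelope P φ where
  isIso_of_fac : ∀ g : F ⟶ F, φ ≫ g = φ → IsIso g

/-- A class of modules is enveloping if every module has an envelope in it. -/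
def IsEnveloping {R : Type u} [CommRing R] (P : ObjectProperty (ModuleCat.{u} R)) : Prop :=
  ∀ M : ModuleCat.{u} R, ∃ (F : ModuleCat.{u} R) (φ : M ⟶ F), IsEnvelope P φ

/-! By the equational criterion, semi-regular flatness says that every relation whose coefficients
generate a semi-regular ideal is trivial (`semiregularFlat_iff`). Closing the image of M under
chosen witnesses bounds the size of the flat submodules needed (`exists_semiregularFlat_submodule`).
Coherence gives closure under products (`semiregularFlat_pi`), so a product over a set of small
targets is a preenvelope.

Intersections of chains are inverse limits, so Zorn yields a preenvelope S with no proper flat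
submodule containing the image of M. Let g be an endomorphism of S over M. A long inverse system
with S at successor stages, whose successor transitions factor through g, has a flat limit, and M
maps into a small flat submodule N of it. Smallness makes N embed in all late stages; by minimality
it fills S at a successor stage, and there its embedding one stage lower passes through g. So g is
injective, and minimality applied to its image makes it surjective. -/

open TensorProduct Module

/-! ### Vanishing of Tor and triviality of relations -/

section LinearAlgebra

variable {R : Type u} [CommRing R]

theorem mem_ideal_span_range_smul_iff {N : Type*} [AddCommGroup N] [Module R N] {n : ℕ}
    (a : Fin n → R) (S : Submodule R N) (x : N) :
    x ∈ Ideal.span (Set.range a) • S ↔ ∃ k : Fin n → N, (∀ i, k i ∈ S) ∧ x = ∑ i, a i • k i := by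
  constructor
  · intro hx
    refine Submodule.smul_induction_on hx ?_ ?_
    · intro r hr y hy
      obtain ⟨c, rfl⟩ := (Ideal.mem_span_range_iff_exists_fun).1 hr
      exact ⟨fun i => c i • y, fun i => S.smul_mem _ hy, by
        rw [Finset.sum_smul]
        exact Finset.sum_congr rfl fun i _ => by rw [mul_comm, mul_smul]⟩
    · rintro _ _ ⟨k, hk, rfl⟩ ⟨l, hl, rfl⟩
      exact ⟨fun i => k i + l i, fun i => S.add_mem (hk i) (hl i), by
        simp [Finset.sum_add_distrib]⟩
  · rintro ⟨k, hk, rfl⟩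
    exact Submodule.sum_mem _ fun i _ =>
      Submodule.smul_mem_smul (Ideal.subset_span ⟨i, rfl⟩) (hk i)

theorem one_tmul_eq_zero_iff {N : Type*} [AddCommGroup N] [Module R N] (I : Ideal R) (x : N) :
    (1 : R ⧸ I) ⊗ₜ[R] x = 0 ↔ x ∈ I • (⊤ : Submodule R N) := by
  rw [← (quotTensorEquivQuotSMul N I).map_eq_zero_iff]
  have := quotTensorEquivQuotSMul_mk_tmul (M := N) I 1 x
  rw [map_one, one_smul] at this
  rw [this, Submodule.Quotient.mk_eq_zero]

theorem exists_one_tmul_eq {N : Type*} [AddCommGroup N] [Module R N] (I : Ideal R)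
    (z : (R ⧸ I) ⊗[R] N) : ∃ x : N, (1 : R ⧸ I) ⊗ₜ[R] x = z := by
  induction z with
  | zero => exact ⟨0, by simp⟩
  | tmul r x =>
    obtain ⟨r, rfl⟩ := Ideal.Quotient.mk_surjective r
    exact ⟨r • x, by
      rw [← smul_tmul]
      congr 1
      rw [← Ideal.Quotient.algebraMap_eq, Algebra.algebraMap_eq_smul_one]⟩
  | add y z hy hz =>
    obtain ⟨y, rfl⟩ := hy
    obtain ⟨z, rfl⟩ := hz
    exact ⟨y + z, by rw [tmul_add]⟩

/-- Exactness of `R ⧸ I ⊗ P₂ → R ⧸ I ⊗ P₁ → R ⧸ I ⊗ P₀` for a partial flat resolution of `M`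
amounts to the triviality of the relations in `M` with coefficients the generators of `I`. -/
theorem lTensor_exact_iff_isTrivialRelation {P₂ P₁ P₀ M : Type*} [AddCommGroup P₂]
    [AddCommGroup P₁] [AddCommGroup P₀] [AddCommGroup M] [Module R P₂] [Module R P₁]
    [Module R P₀] [Module R M] [Flat R P₀] (f : P₂ →ₗ[R] P₁) (g : P₁ →ₗ[R] P₀)
    (p : P₀ →ₗ[R] M) (hfg : Function.Exact f g) (hgp : Function.Exact g p)
    (hp : Function.Surjective p) {n : ℕ} (a : Fin n → R) :
    (∀ x : (R ⧸ Ideal.span (Set.range a)) ⊗[R] P₁, g.lTensor _ x = 0 →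
      ∃ y, f.lTensor _ y = x) ↔
    ∀ m : Fin n → M, ∑ i, a i • m i = 0 → IsTrivialRelation a m := by
  constructor
  · intro H m hm
    choose q hq using fun i => hp (m i)
    have h0 : p (∑ i, a i • q i) = 0 := by simp [hq, hm]
    obtain ⟨x, hx⟩ := (hgp _).1 h0
    obtain ⟨y, hy⟩ := H (1 ⊗ₜ x) (by
      rw [LinearMap.lTensor_tmul, one_tmul_eq_zero_iff, mem_ideal_span_range_smul_iff]
      exact ⟨q, by simp, hx⟩)
    obtain ⟨y, rfl⟩ := exists_one_tmul_eq _ y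
    rw [LinearMap.lTensor_tmul, ← sub_eq_zero, ← tmul_sub, one_tmul_eq_zero_iff,
      mem_ideal_span_range_smul_iff] at hy
    obtain ⟨k, -, hk⟩ := hy
    have hk' := congrArg g hk
    rw [map_sub, hfg.apply_apply_eq_zero, hx, zero_sub] at hk'
    -- Exactness corrects the lifts `q i` by boundaries, turning the relation in M into one in the
    -- flat module P₀, where it is trivial.
    have hrel : ∑ i, a i • (q i + g (k i)) = 0 := by
      simp only [smul_add, Finset.sum_add_distrib]
      rw [map_sum] at hk'
      simp only [map_smul] at hk'
      rw [← hk', add_neg_cancel]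
    obtain ⟨l, r, z, hz, hr⟩ := Flat.isTrivialRelation_of_sum_smul_eq_zero hrel
    refine ⟨l, r, fun j => p (z j), fun i => ?_, hr⟩
    have := congrArg p (hz i)
    rw [map_add, hgp.apply_apply_eq_zero, add_zero, hq] at this
    simpa using this
  · intro H x hx
    obtain ⟨x, rfl⟩ := exists_one_tmul_eq _ x
    rw [LinearMap.lTensor_tmul, one_tmul_eq_zero_iff, mem_ideal_span_range_smul_iff] at hx
    obtain ⟨q, -, hq⟩ := hx
    obtain ⟨l, r, z, hz, hr⟩ := H (fun i => p (q i)) (by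
      simpa [hgp.apply_apply_eq_zero] using (congrArg p hq).symm)
    choose w hw using fun j => hp (z j)
    have hker : ∀ i, ∃ k, g k = q i - ∑ j, r i j • w j := fun i =>
      (hgp _).1 (by simp [hw, hz i])
    choose k hk using hker
    have hsum : ∑ i, a i • ∑ j, r i j • w j = 0 := by
      simp_rw [Finset.smul_sum, smul_smul]
      rw [Finset.sum_comm]
      simp_rw [← Finset.sum_smul, hr, zero_smul, Finset.sum_const_zero]
    have hgx : g (x - ∑ i, a i • k i) = 0 := by
      simp [hk, smul_sub, Finset.sum_sub_distrib, hsum, hq]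
    obtain ⟨y, hy⟩ := (hfg _).1 hgx
    refine ⟨1 ⊗ₜ y, ?_⟩
    rw [LinearMap.lTensor_tmul, hy, ← sub_eq_zero, ← tmul_sub, one_tmul_eq_zero_iff,
      mem_ideal_span_range_smul_iff]
    exact ⟨fun i => - k i, by simp, by simp⟩

end LinearAlgebra

theorem isZero_tor_one_iff {R : Type u} [CommRing R] (M : ModuleCat.{u} R) {n : ℕ}
    (a : Fin n → R) :
    Limits.IsZero (((Tor (ModuleCat.{u} R) 1).obj
      (ModuleCat.of R (R ⧸ Ideal.span (Set.range a)))).obj M) ↔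
    ∀ m : Fin n → M, ∑ i, a i • m i = 0 → IsTrivialRelation a m := by
  let P : ProjectiveResolution M := ProjectiveResolution.of M
  let F := (MonoidalCategory.tensoringLeft (ModuleCat.{u} R)).obj
    (ModuleCat.of R (R ⧸ Ideal.span (Set.range a)))
  have h1 := (P.isoLeftDerivedObj F 1).isZero_iff
  have : Projective (P.complex.X 0) := P.projective 0
  have : Module.Projective R (P.complex.X 0) :=
    (IsProjective.iff_projective (P.complex.X 0)).2 inferInstance
  have hfg : Function.Exact (P.complex.d 2 1).hom (P.complex.d 1 0).hom := by
    have := P.exact_succ 0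
    rw [ShortComplex.ShortExact.moduleCat_exact_iff_function_exact] at this
    exact this
  have hgp : Function.Exact (P.complex.d 1 0).hom (P.π.f 0).hom := by
    have := P.exact₀
    rw [ShortComplex.ShortExact.moduleCat_exact_iff_function_exact] at this
    exact this
  have hp : Function.Surjective (P.π.f 0).hom :=
    (ModuleCat.epi_iff_surjective _).1 inferInstance
  refine h1.trans (Iff.trans ?_ (lTensor_exact_iff_isTrivialRelation (M := M)
    (P.complex.d 2 1).hom (P.complex.d 1 0).hom (P.π.f 0).hom hfg hgp hp a))
  refine (HomologicalComplex.exactAt_iff_isZero_homology _ 1).symm.trans ?_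
  rw [HomologicalComplex.exactAt_iff' _ 2 1 0 (by simp) (by simp),
    ShortComplex.moduleCat_exact_iff]
  rfl

/-- Semi-regular flatness of `M`, as a condition on the relations in `M`. -/
theorem semiregularFlat_iff {R : Type u} [CommRing R] (M : ModuleCat.{u} R) :
    semiregularFlat R M ↔ ∀ (n : ℕ) (a : Fin n → R),
      IsSemiregularIdeal (Ideal.span (Set.range a)) →
      ∀ m : Fin n → M, ∑ i, a i • m i = 0 → IsTrivialRelation a m := by
  constructor
  · intro h n a ha
    exact (isZero_tor_one_iff M a).1
      (h _ (Submodule.fg_span (Set.finite_range a)) ha)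
  · intro h I hI hsr
    obtain ⟨n, a, rfl⟩ := Submodule.fg_iff_exists_fin_generating_family.1 hI
    exact (isZero_tor_one_iff M a).2 (h n a hsr)

/-! ### Flat submodules of bounded size -/

/-- Formal terms in variables from `M`: besides linear combinations (`none`), a family of terms
`t` and coefficients `a` have formal witnesses (`some j`, for `j : ℕ`) of the triviality of the
relation `∑ i, a i • t i = 0`. -/
inductive RelationTerm (R M : Type u) : Type u
  | var (m : M) : RelationTerm R M
  | app (n : ℕ) (a : Fin n → R) (o : Option ℕ) (t : Fin n → RelationTerm R M) : RelationTerm R M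

/-- The value of a term, given the values of the variables and a choice of witnesses. -/
def RelationTerm.eval {R M F : Type u} [CommRing R] [AddCommGroup F] [Module R F] (f : M → F)
    (w : ∀ n : ℕ, (Fin n → R) → (Fin n → F) → ℕ → F) : RelationTerm R M → F
  | var m => f m
  | app _ a none t => ∑ i, a i • (t i).eval f w
  | app n a (some j) t => w n a (fun i => (t i).eval f w) j

section Semiregular

variable {R : Type u} [CommRing R]

instance : (semiregularFlat R).IsClosedUnderIsomorphisms where
  of_iso e h I hI hsr := (h I hI hsr).of_iso
    (((Tor (ModuleCat.{u} R) 1).obj (ModuleCat.of R (R ⧸ I))).mapIso e.symm)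

/-- The submodule of the values of terms. -/
def RelationTerm.evalRange {M F : Type u} [AddCommGroup F] [Module R F] (f : M → F)
    (w : ∀ n : ℕ, (Fin n → R) → (Fin n → F) → ℕ → F) : Submodule R F where
  carrier := Set.range (RelationTerm.eval f w)
  zero_mem' := ⟨app 0 ![] none ![], by simp [eval]⟩
  add_mem' := by
    rintro _ _ ⟨s, rfl⟩ ⟨t, rfl⟩
    exact ⟨app 2 ![1, 1] none ![s, t], by simp [eval]⟩
  smul_mem' := by
    rintro r _ ⟨s, rfl⟩
    exact ⟨app 1 ![r] none ![s], by simp [eval]⟩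

/-- Witnesses are sequences indexed by ℕ, so that their type does not depend on the number k
actually used and they can serve as operations on terms. -/
theorem exists_trivialRelation_witness (F : ModuleCat.{u} R) (hF : semiregularFlat R F) :
    ∃ w : ∀ n : ℕ, (Fin n → R) → (Fin n → F) → ℕ → F,
      ∀ (n : ℕ) (a : Fin n → R) (m : Fin n → F), IsSemiregularIdeal (Ideal.span (Set.range a)) →
        ∑ i, a i • m i = 0 → ∃ (k : ℕ) (r : Fin n → Fin k → R),
          (∀ i, m i = ∑ j, r i j • w n a m j) ∧ ∀ j, ∑ i, a i * r i j = 0 := by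
  have h : ∀ (n : ℕ) (a : Fin n → R) (m : Fin n → F), ∃ w : ℕ → F,
      IsSemiregularIdeal (Ideal.span (Set.range a)) →
        ∑ i, a i • m i = 0 → ∃ (k : ℕ) (r : Fin n → Fin k → R),
          (∀ i, m i = ∑ j, r i j • w j) ∧ ∀ j, ∑ i, a i * r i j = 0 := by
    intro n a m
    by_cases h : IsSemiregularIdeal (Ideal.span (Set.range a)) ∧ ∑ i, a i • m i = 0
    · obtain ⟨k, r, y, hy, hr⟩ := (semiregularFlat_iff F).1 hF n a h.1 m h.2
      exact ⟨fun j => if hj : j < k then y ⟨j, hj⟩ else 0, fun _ _ => ⟨k, r, by simpa using hy, hr⟩⟩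
    · exact ⟨0, fun h₁ h₂ => (h ⟨h₁, h₂⟩).elim⟩
  choose w hw using h
  exact ⟨w, hw⟩

/-- A module contained in a semi-regular flat module is contained in a semi-regular flat submodule
of bounded size. -/
theorem exists_semiregularFlat_submodule {M F : ModuleCat.{u} R} (hF : semiregularFlat R F)
    (f : M ⟶ F) : ∃ N : Submodule R F, LinearMap.range f.hom ≤ N ∧
      semiregularFlat R (ModuleCat.of R N) ∧
      ∃ e : RelationTerm R M → N, Function.Surjective e := by
  obtain ⟨w, hw⟩ := exists_trivialRelation_witness F hF
  refine ⟨RelationTerm.evalRange f w, ?_, ?_,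
    fun t => ⟨t.eval f w, t, rfl⟩, fun ⟨_, t, ht⟩ => ⟨t, Subtype.ext ht⟩⟩
  · rintro _ ⟨m, rfl⟩
    exact ⟨.var m, rfl⟩
  · rw [semiregularFlat_iff]
    intro n a ha m hm
    change ∑ i, a i • (m i : RelationTerm.evalRange f w) = 0 at hm
    have hm' := congrArg (RelationTerm.evalRange f w).subtype hm
    simp only [map_sum, map_smul, map_zero, Submodule.subtype_apply] at hm'
    obtain ⟨k, r, hr, har⟩ := hw n a (fun i => (m i).1) ha hm'
    choose t ht using fun i => (m i).2
    -- The witnesses for values of terms are themselves values of terms, so triviality in F descends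
    -- to the submodule.
    have hmem : ∀ j : ℕ, w n a (fun i => (m i).1) j ∈ RelationTerm.evalRange f w := fun j =>
      ⟨.app n a (some j) t, by simp only [RelationTerm.eval, ht]⟩
    refine ⟨k, r, fun j => ⟨_, hmem j⟩, fun i => ?_, har⟩
    apply (RelationTerm.evalRange f w).injective_subtype
    refine (hr i).trans ?_
    simp only [map_sum, map_smul, Submodule.subtype_apply]

/-! ### Products and preenvelopes -/

/-- Over a semi-regular coherent ring, semi-regular flat modules are closed under products. -/
theorem semiregularFlat_pi (hcoh : IsSemiregularCoherent R) {ι : Type u} (F : ι → Type u)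
    [∀ i, AddCommGroup (F i)] [∀ i, Module R (F i)]
    (hF : ∀ i, semiregularFlat R (ModuleCat.of R (F i))) :
    semiregularFlat R (ModuleCat.of R (∀ i, F i)) := by
  rw [semiregularFlat_iff]
  intro n a ha m hm
  have hfp := hcoh _ (Submodule.fg_span (Set.finite_range a)) ha
  let l := Fintype.linearCombination R a
  have hl : LinearMap.range l = Ideal.span (Set.range a) := Fintype.range_linearCombination R a
  have : Module.FinitePresentation R (LinearMap.range l) := hl ▸ hfp
  -- The syzygies of `a` have finitely many generators `s j`; these serve as the same coefficients
  -- in every factor, so the witnesses assemble into elements of the product.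
  have hfg := Module.FinitePresentation.fg_ker l.rangeRestrict l.surjective_rangeRestrict
  rw [LinearMap.ker_rangeRestrict] at hfg
  obtain ⟨k, s, hs⟩ := Submodule.fg_iff_exists_fin_generating_family.1 hfg
  have hsl : ∀ j, ∑ i, a i * s j i = 0 := fun j => by
    have : s j ∈ LinearMap.ker l := hs ▸ Submodule.subset_span ⟨j, rfl⟩
    simpa [l, Fintype.linearCombination_apply, mul_comm] using this
  have key : ∀ x : ι, ∃ y : Fin k → F x, ∀ i, m i x = ∑ j, s j i • y j := by
    intro x
    obtain ⟨k', r, z, hz, hr⟩ := (semiregularFlat_iff _).1 (hF x) n a ha (fun i => m i x) (by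
      have := congrFun hm x
      rw [Finset.sum_apply] at this
      exact this)
    have hmem : ∀ j', ∃ c : Fin k → R, ∑ j, c j • s j = fun i => r i j' := fun j' => by
      rw [← Submodule.mem_span_range_iff_exists_fun, hs]
      simpa [l, Fintype.linearCombination_apply, mul_comm] using hr j'
    choose c hc using hmem
    refine ⟨fun j => ∑ j', c j' j • (z j' : F x), fun i => (hz i).trans ?_⟩
    have hc' : ∀ j', r i j' = ∑ j, c j' j * s j i := fun j' => by
      simpa using (congrFun (hc j') i).symm
    simp_rw [hc', Finset.sum_smul, Finset.smul_sum]
    rw [Finset.sum_comm]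
    refine Finset.sum_congr rfl fun j _ => Finset.sum_congr rfl fun j' _ => ?_
    rw [mul_comm, mul_smul]
  choose y hy using key
  refine ⟨k, fun i j => s j i, fun j x => y x j, fun i => ?_, hsl⟩
  funext x
  refine (hy x i).trans ?_
  exact (Finset.sum_apply x Finset.univ fun j => s j i • fun x => y x j).symm

/-- Every map from M to a flat module factors through a flat quotient of the free module on
`RelationTerm R M`. The maps from M to such quotients form a set, and their product is the
preenvelope. -/
theorem exists_isPreenvelope (hcoh : IsSemiregularCoherent R) (M : ModuleCat.{u} R) :
    ∃ (F : ModuleCat.{u} R) (φ : M ⟶ F), IsPreenvelope (semiregularFlat R) φ := by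
  let T := RelationTerm R M
  let A := {N : Submodule R (T →₀ R) // semiregularFlat R (ModuleCat.of R ((T →₀ R) ⧸ N))}
  let ι := Σ N : A, M →ₗ[R] (T →₀ R) ⧸ N.1
  let G : ι → Type u := fun i => (T →₀ R) ⧸ i.1.1
  let _ : ∀ i, AddCommGroup (G i) := fun i => inferInstanceAs (AddCommGroup ((T →₀ R) ⧸ i.1.1))
  let _ : ∀ i, Module R (G i) := fun i => inferInstanceAs (Module R ((T →₀ R) ⧸ i.1.1))
  refine ⟨ModuleCat.of R (∀ i, G i),
    ModuleCat.ofHom (LinearMap.pi fun i : ι => i.2),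
    semiregularFlat_pi hcoh _ fun i => i.1.2, fun F' hF' f => ?_⟩
  obtain ⟨N, hfN, hN, e, he⟩ := exists_semiregularFlat_submodule hF' f
  let q : (T →₀ R) →ₗ[R] N := Finsupp.linearCombination R e
  have hq : Function.Surjective q := fun x => by
    obtain ⟨t, rfl⟩ := he x
    exact ⟨Finsupp.single t 1, by simp [q]⟩
  let ε : ((T →₀ R) ⧸ LinearMap.ker q) ≃ₗ[R] N := q.quotKerEquivOfSurjective hq
  let f' : M →ₗ[R] N := f.hom.codRestrict N fun m => hfN ⟨m, rfl⟩
  let i : ι := ⟨⟨LinearMap.ker q, (semiregularFlat R).prop_of_iso ε.symm.toModuleIso hN⟩,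
    ε.symm.toLinearMap ∘ₗ f'⟩
  refine ⟨ModuleCat.ofHom (N.subtype ∘ₗ ε.toLinearMap ∘ₗ LinearMap.proj i), ?_⟩
  ext m
  change (ε (ε.symm (f' m)) : F') = f m
  rw [LinearEquiv.apply_symm_apply]
  rfl

end Semiregular

/-! ### Minimal preenvelopes -/

section Envelopes

open Limits SmallObject

variable {R : Type u} [CommRing R]

/-- The intersection is the limit of the chain under inclusions: directedness makes all legs of a
cone agree as maps into F. -/
theorem prop_sInf_of_isChain {P : ObjectProperty (ModuleCat.{u} R)}
    (hP : IsClosedUnderInverseLimits P) {F : ModuleCat.{u} R} {c : Set (Submodule R F)}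
    (hc : IsChain (· ≤ ·) c) (hne : c.Nonempty) (hcP : ∀ N ∈ c, P (ModuleCat.of R N)) :
    P (ModuleCat.of R (sInf c : Submodule R F)) := by
  let J := (↥c)ᵒᵈ
  have : Nonempty J := hne.to_subtype
  have : IsDirectedOrder J := ⟨fun a b => by
    rcases hc.total (OrderDual.ofDual a).2 (OrderDual.ofDual b).2 with h | h
    · exact ⟨a, le_rfl, h⟩
    · exact ⟨b, h, le_rfl⟩⟩
  let D : Jᵒᵖ ⥤ ModuleCat.{u} R :=
    { obj := fun j => ModuleCat.of R (OrderDual.ofDual j.unop).1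
      map := fun f => ModuleCat.ofHom (Submodule.inclusion (leOfHom f.unop)) }
  let s : Cone D :=
    { pt := ModuleCat.of R (sInf c : Submodule R F)
      π := { app := fun j => ModuleCat.ofHom (Submodule.inclusion
              (sInf_le (OrderDual.ofDual j.unop).2)) } }
  let v : ∀ j, D.obj j →ₗ[R] F := fun j => (OrderDual.ofDual j.unop).1.subtype
  have aux : ∀ (t : Cone D) (x : t.pt) (i j : Jᵒᵖ) (_ : i ⟶ j),
      v i ((t.π.app i).hom x) = v j ((t.π.app j).hom x) := by
    intro t x i j h
    rw [← t.w h]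
    rfl
  have hval : ∀ (t : Cone D) (x : t.pt) (i j : Jᵒᵖ),
      v i ((t.π.app i).hom x) = v j ((t.π.app j).hom x) := by
    intro t x i j
    obtain ⟨k, hik, hjk⟩ := directed_of (· ≤ ·) i.unop j.unop
    exact (aux t x (.op k) i (homOfLE hik).op).symm.trans (aux t x (.op k) j (homOfLE hjk).op)
  let j₀ : Jᵒᵖ := .op (Classical.arbitrary J)
  have hs : IsLimit s :=
    { lift := fun t => ModuleCat.ofHom ((v j₀ ∘ₗ (t.π.app j₀).hom).codRestrict (sInf c)
        fun x => by
          rw [Submodule.mem_sInf]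
          intro N hN
          let j : Jᵒᵖ := .op (OrderDual.toDual ⟨N, hN⟩)
          change v j₀ ((t.π.app j₀).hom x) ∈ N
          rw [hval t x j₀ j]
          exact (show N from (t.π.app j).hom x).2)
      fac := fun t j => by
        ext x
        exact hval t x j₀ j
      uniq := fun t m hm => by
        ext x
        change _ = v j₀ ((t.π.app j₀).hom x)
        rw [← hm j₀]
        rfl }
  have := hP J
  exact P.prop_of_isLimit hs fun j => hcP _ (OrderDual.ofDual j.unop).2

/-- A module with a preenvelope has a preenvelope no proper submodule of which is one. -/
theorem IsPreenvelope.exists_minimal {P : ObjectProperty (ModuleCat.{u} R)}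
    [P.IsClosedUnderIsomorphisms] (hP : IsClosedUnderInverseLimits P)
    {M F : ModuleCat.{u} R} {φ : M ⟶ F} (hφ : IsPreenvelope P φ) :
    ∃ (S : ModuleCat.{u} R) (ψ : M ⟶ S), IsPreenvelope P ψ ∧
      ∀ N : Submodule R S, LinearMap.range ψ.hom ≤ N → P (ModuleCat.of R N) → N = ⊤ := by
  let c : Set (Submodule R F)ᵒᵈ :=
    {N | LinearMap.range φ.hom ≤ OrderDual.ofDual N ∧
      P (ModuleCat.of R (OrderDual.ofDual N : Submodule R F))}
  obtain ⟨S, -, hS⟩ := zorn_le_nonempty₀ c (fun d hdc hd y hy => by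
    let d' : Set (Submodule R F) := d
    refine ⟨OrderDual.toDual (sInf d'), ⟨le_sInf fun N hN => (hdc hN).1,
      prop_sInf_of_isChain hP hd.symm ⟨y, hy⟩ fun N hN => (hdc hN).2⟩, fun N hN => ?_⟩
    exact sInf_le (α := Submodule R F) hN) (OrderDual.toDual ⊤)
    ⟨le_top, P.prop_of_iso Submodule.topEquiv.symm.toModuleIso hφ.mem⟩
  obtain ⟨S, rfl⟩ := OrderDual.toDual.surjective S
  have hle : ∀ m, φ.hom m ∈ S := fun m => hS.prop.1 ⟨m, rfl⟩
  refine ⟨ModuleCat.of R S, ModuleCat.ofHom (φ.hom.codRestrict S hle), ⟨hS.prop.2, ?_⟩, ?_⟩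
  · intro F' hF' f
    obtain ⟨g, hg⟩ := hφ.exists_fac F' hF' f
    exact ⟨ModuleCat.ofHom S.subtype ≫ g, hg⟩
  · intro N hN hPN
    -- Minimality of S was obtained among submodules of F, so N is transported there.
    have hmem : OrderDual.toDual (N.map S.subtype) ∈ c := by
      refine ⟨?_, P.prop_of_iso (Submodule.equivMapOfInjective S.subtype
        S.injective_subtype N).toModuleIso hPN⟩
      rintro _ ⟨m, rfl⟩
      exact ⟨⟨_, hle m⟩, hN ⟨m, rfl⟩, rfl⟩
    have := hS.le_of_ge hmem (Submodule.map_subtype_le S N)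
    rw [eq_top_iff]
    rintro x -
    obtain ⟨y, hy, hyx⟩ := this x.2
    rwa [← Subtype.ext hyx]

/-- An unbounded family would have cofinal range, too small for the cofinality of J. -/
theorem exists_forall_le_of_card_le {J T : Type u} [LinearOrder J] (hT : Cardinal.mk T < Order.cof J)
    (f : T → J) : ∃ j, ∀ t, f t ≤ j := by
  by_contra! h
  have hcof : IsCofinal (Set.range f) := fun j => by
    obtain ⟨t, ht⟩ := h j
    exact ⟨_, ⟨t, rfl⟩, ht.le⟩
  exact ((Order.cof_le hcof).trans Cardinal.mk_range_le).not_gt hT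

/-! ### Transfinite inverse systems under M -/

section Iteration

variable {M : ModuleCat.{u} R}

/-- A successor structure on modules under `M`, with arrows reversed, whose successor morphisms
factor through a fixed endomorphism `g` of `U` whenever possible. -/
theorem exists_succStruct (U : Under M) (g : U ⟶ U) :
    ∃ Φ : SuccStruct (Under M)ᵒᵖ, Φ.X₀ = Opposite.op U ∧ ∀ X : Under M, Nonempty (U ⟶ X) →
      ∃ (e : Φ.succ (.op X) ≅ Opposite.op U) (c : U ⟶ X),
        Φ.toSucc (.op X) = c.op ≫ g.op ≫ e.inv := by
  have h : ∀ X : (Under M)ᵒᵖ, ∃ (Y : (Under M)ᵒᵖ) (t : X ⟶ Y), Nonempty (U ⟶ X.unop) →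
      ∃ (e : Y ≅ Opposite.op U) (c : U ⟶ X.unop), t = c.op ≫ g.op ≫ e.inv := by
    intro X
    by_cases hX : Nonempty (U ⟶ X.unop)
    · exact ⟨.op U, hX.some.op ≫ g.op, fun _ => ⟨Iso.refl _, hX.some, by simp⟩⟩
    -- Junk value: every stage reached later is in `P`, so it receives a map from the preenvelope.
    · exact ⟨X, 𝟙 X, fun h => (hX h).elim⟩
  choose succ toSucc hs using h
  exact ⟨⟨.op U, succ, toSucc⟩, rfl, fun X => hs (.op X)⟩

/-- A colimit in the opposite category is a limit under M, and forgetting M preserves it. -/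
theorem prop_of_isWellOrderContinuous {P : ObjectProperty (ModuleCat.{u} R)}
    (hP : IsClosedUnderInverseLimits P) {J : Type u} [LinearOrder J]
    (G : J ⥤ (Under M)ᵒᵖ) [G.IsWellOrderContinuous] (j : J)
    (hj : Order.IsSuccLimit j) (h : ∀ i < j, P (G.obj i).unop.right) :
    P (G.obj j).unop.right := by
  have : Nonempty (Set.Iio j) := hj.nonempty_Iio.to_subtype
  have := hP (Set.Iio j)
  exact P.prop_of_isLimit (isLimitOfPreserves (Under.forget M) (isLimitConeLeftOpOfCocone _
    (G.isColimitOfIsWellOrderContinuous j hj))) fun i => h _ i.unop.2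

end Iteration

/-- If every map from `M` to a module in `P` factors through a submodule in `P` of bounded size,
every endomorphism of a minimal preenvelope of `M` over the identity of `M` is injective. -/
theorem IsPreenvelope.injective_of_minimal {P : ObjectProperty (ModuleCat.{u} R)}
    [P.IsClosedUnderIsomorphisms] (hP : IsClosedUnderInverseLimits P)
    {M S : ModuleCat.{u} R} {φ : M ⟶ S} (hφ : IsPreenvelope P φ)
    (hmin : ∀ N : Submodule R S, LinearMap.range φ.hom ≤ N → P (ModuleCat.of R N) → N = ⊤)
    (T : Type u) (hT : ∀ (F : ModuleCat.{u} R) (f : M ⟶ F), P F →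
      ∃ N : Submodule R F, LinearMap.range f.hom ≤ N ∧ P (ModuleCat.of R N) ∧
        ∃ e : T → N, Function.Surjective e)
    (g : S ⟶ S) (hg : φ ≫ g = φ) : Function.Injective g.hom := by
  -- A regular cardinal above the size of T, so that T-indexed families of stages are bounded.
  let κ : Cardinal.{u} := Order.succ (max Cardinal.aleph0 (Cardinal.mk T))
  have hκ : κ.IsRegular := Cardinal.isRegular_succ (le_max_left _ _)
  let J := κ.ord.ToType
  have : Nonempty J := Ordinal.nonempty_toType_iff.2 hκ.ord_pos.ne'
  let _ : OrderBot J := WellFoundedLT.toOrderBot J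
  have : NoMaxOrder J := Cardinal.noMaxOrder hκ.aleph0_le
  have hcof : Cardinal.mk T < Order.cof J := by
    rw [Ordinal.cof_toType, hκ.cof_ord]
    exact Order.lt_succ_of_le (le_max_right _ _)
  let U : Under M := Under.mk φ
  let gU : U ⟶ U := Under.homMk g hg
  obtain ⟨Φ, hΦ₀, hΦ⟩ := exists_succStruct U gU
  have hne : ∀ X : Under M, P X.right → Nonempty (U ⟶ X) := fun X hX => by
    obtain ⟨f, hf⟩ := hφ.exists_fac _ hX X.hom
    exact ⟨Under.homMk f hf⟩
  let G : J ⥤ (Under M)ᵒᵖ := Φ.iterationFunctor J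
  have hPU : ∀ X : (Under M)ᵒᵖ, (X ≅ .op U) → P X.unop.right := fun X e =>
    P.prop_of_iso ((Under.forget M).mapIso e.unop) hφ.mem
  have hG : ∀ j, P (G.obj j).unop.right := by
    intro j
    induction j using SuccOrder.limitRecOn with
    | isMin j hj =>
      obtain rfl := hj.eq_bot
      exact hPU _ (Φ.iterationFunctorObjBotIso J ≪≫ eqToIso hΦ₀)
    | succ j hj ih =>
      obtain ⟨e, -⟩ := hΦ _ (hne _ ih)
      exact hPU _ (Φ.iterationFunctorObjSuccIso j hj ≪≫ e)
    | isSuccLimit j hj ih => exact prop_of_isWellOrderContinuous hP G j hj ih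
  let D : Jᵒᵖ ⥤ ModuleCat.{u} R := G.leftOp ⋙ Under.forget M
  have hPL : P (limit D) := by
    have := hP J
    exact P.prop_limit D fun j => hG j.unop
  let s : Cone D :=
    { pt := M
      π := { app := fun j => (G.obj j.unop).unop.hom
             naturality := fun i j f => by
               simp [D] } }
  obtain ⟨N, hsN, hPN, e, he⟩ := hT _ (limit.lift D s) hPL
  let π : ∀ j : J, N →ₗ[R] (G.obj j).unop.right := fun j =>
    (limit.π D (.op j)).hom ∘ₗ N.subtype
  have hπ : ∀ i j (h : i ≤ j) x, (G.map (homOfLE h)).unop.right.hom (π j x) = π i x := by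
    intro i j h x
    have := limit.w D (homOfLE h).op
    exact congrArg (fun f => f.hom x.1) this
  have hπM : ∀ j m, ∃ x, π j x = (G.obj j).unop.hom.hom m := fun j m =>
    ⟨⟨_, hsN ⟨m, rfl⟩⟩, congrArg (fun f => f.hom m) (limit.lift_π s (.op j))⟩
  have hzero : ∀ x : N, (∀ j, π j x = 0) → x = 0 := fun x hx => by
    apply N.injective_subtype
    refine Concrete.limit_ext D _ _ fun j => ?_
    rw [map_zero, map_zero]
    exact hx j.unop
  -- A nonzero element of N is nonzero at some stage, hence at all later ones; a common bound j for
  -- these stages makes N embed from j on.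
  have hex : ∀ t : T, ∃ j : J, π j (e t) = 0 → e t = 0 := fun t => by
    by_contra! h
    exact (h ⊥).2 (hzero _ fun j => (h j).1)
  choose f hf using hex
  obtain ⟨j, hj⟩ := exists_forall_le_of_card_le hcof f
  have hinj : ∀ i, j ≤ i → Function.Injective (π i) := fun i hi => by
    rw [← LinearMap.ker_eq_bot, LinearMap.ker_eq_bot']
    intro x hx
    obtain ⟨t, rfl⟩ := he x
    apply hf
    rw [← hπ _ _ ((hj t).trans hi), hx, map_zero]
  obtain ⟨e', c, hc⟩ := hΦ _ (hne _ (hG j))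
  let ε : (G.obj (Order.succ j)) ≅ .op U := Φ.iterationFunctorObjSuccIso j (not_isMax j) ≪≫ e'
  have hmap : (G.map (homOfLE (Order.le_succ j))).unop = ε.inv.unop ≫ gU ≫ c := by
    have := Φ.iterationFunctor_map_succ j (not_isMax j)
    change Φ.toSucc _ = _ at hc
    rw [hc] at this
    rw [show G.map (homOfLE (Order.le_succ j)) = _ from this]
    simp [ε]
  let α := ε.inv.unop.right
  let θ : N →ₗ[R] S := α.hom ∘ₗ π (Order.succ j)
  have hα : Function.Injective α.hom :=
    ((Under.forget M).mapIso ε.symm.unop).toLinearEquiv.injective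
  have hθ : Function.Injective θ := hα.comp (hinj _ (Order.le_succ j))
  -- The image of N at the successor stage, identified with S, is in `P` and contains the image of
  -- M.
  have hθtop : LinearMap.range θ = ⊤ := by
    refine hmin _ ?_ (P.prop_of_iso (LinearEquiv.ofInjective θ hθ).toModuleIso hPN)
    rintro _ ⟨m, rfl⟩
    obtain ⟨x, hx⟩ := hπM (Order.succ j) m
    refine ⟨x, ?_⟩
    change α.hom (π (Order.succ j) x) = _
    rw [hx]
    exact congrArg (fun f => f.hom m) (Under.w ε.inv.unop)
  -- The transition from stage j + 1 to j passes through g, so injectivity of `π j` forces g to be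
  -- injective on the range of θ, which is all of S.
  have hτ : ∀ x, c.right.hom (g.hom (θ x)) = π j x := fun x => by
    rw [← hπ j _ (Order.le_succ j) x, hmap]
    rfl
  intro a b hab
  obtain ⟨x, rfl⟩ := LinearMap.range_eq_top.1 hθtop a
  obtain ⟨y, rfl⟩ := LinearMap.range_eq_top.1 hθtop b
  rw [hinj j le_rfl ((hτ x).symm.trans ((congrArg c.right.hom hab).trans (hτ y)))]

/-- If every map from `M` to a module in `P` factors through a submodule in `P` of bounded size,
a minimal preenvelope of `M` is an envelope. -/
theorem IsPreenvelope.isEnvelope_of_minimal {P : ObjectProperty (ModuleCat.{u} R)}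
    [P.IsClosedUnderIsomorphisms] (hP : IsClosedUnderInverseLimits P)
    {M S : ModuleCat.{u} R} {φ : M ⟶ S} (hφ : IsPreenvelope P φ)
    (hmin : ∀ N : Submodule R S, LinearMap.range φ.hom ≤ N → P (ModuleCat.of R N) → N = ⊤)
    (T : Type u) (hT : ∀ (F : ModuleCat.{u} R) (f : M ⟶ F), P F →
      ∃ N : Submodule R F, LinearMap.range f.hom ≤ N ∧ P (ModuleCat.of R N) ∧
        ∃ e : T → N, Function.Surjective e) : IsEnvelope P φ where
  toIsPreenvelope := hφ
  isIso_of_fac g hg := by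
    have hinj := hφ.injective_of_minimal hP hmin T hT g hg
    have htop : LinearMap.range g.hom = ⊤ := by
      refine hmin _ ?_ (P.prop_of_iso (LinearEquiv.ofInjective g.hom hinj).toModuleIso hφ.mem)
      rintro _ ⟨m, rfl⟩
      exact ⟨φ.hom m, congrArg (fun f => f.hom m) hg⟩
    exact (ConcreteCategory.isIso_iff_bijective g).2 ⟨hinj, LinearMap.range_eq_top.1 htop⟩

end Envelopes

theorem corollary4p6 (R : Type u) [CommRing R] (hcoh : IsSemiregularCoherent R)
    (hlim : IsClosedUnderInverseLimits (semiregularFlat R)) :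
    IsEnveloping (semiregularFlat R) := by
  intro M
  obtain ⟨F, φ, hφ⟩ := exists_isPreenvelope hcoh M
  obtain ⟨S, ψ, hψ, hmin⟩ := hφ.exists_minimal hlim
  exact ⟨S, ψ, hψ.isEnvelope_of_minimal hlim hmin (RelationTerm R M)
    fun _ f hF => exists_semiregularFlat_submodule hF f⟩
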